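/- Throughout, vector spaces are real. Let $E$ be a Hausdorff topological vector space with topological dual $E^*$, and let $Z$ be a linear subspace of $E^*$. A set $C\subset E$ has the $\sigma(E,Z)$-approximate fixed point property ($\sigma(E,Z)$-AFPP) if for every continuous map $f\colon C\to C$ (for the topology of $E$) there is a sequence $(x_n)$ in $C$ such that $\varphi(x_n-f(x_n))\to 0$ for every $\varphi\in Z$. The space $E$ has the $\sigma(E,Z)$-AFPP if every nonempty bounded closed convex subset of $E$ has it; here $A\subset E$ is bounded if every neighbourhood $U$ of $0$ admits some $r>0$ with $A\subset rU$. The weak-AFPP is the $\sigma(E,E^*)$-AFPP. A Banach space is Asplund if every continuous convex function on an open convex subset $U$ is Fréchet differentiable at all points of some dense $G_\delta$ subset of $U$. A topological space $T$ has a countable network if there is a countable family $\mathcal N$ of subsets of $T$ such that every open subset of $T$ is a union of members of $\mathcal N$; $T$ is $\aleph_0$-monolithic if every separable subset of $T$ (with the subspace topology) has a countable network. **Proposition.** Let $X$ be a real normed space, with dual $X^*$. (i) Suppose that the completion of $X$ is an Asplund space. Let $\tau$ be any locally convex vector space topology on $X$ compatible with the duality $\langle X,X^*\rangle$, i.e.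 such that the $\tau$-continuous linear functionals on $X$ are exactly the norm-continuous ones. Then $(X,\tau)$ has the weak-AFPP (where boundedness, closedness of sets and continuity of maps refer to $\tau$). (ii) If $(X^*,w^*)$, where $w^*$ is the weak* topology, is $\aleph_0$-monolithic, then $(X^*,\|\cdot\|)$ has the $\sigma(X^*,X)$-AFPP, where $X$ is regarded as a subspace of $X^{**}$ in the canonical way (boundedness, closedness of sets and continuity of maps refer to the norm of $X^*$). -/

import Mathlib

open Filter Topology

namespace AFPP

section TVS

variable (E : Type*) [AddCommGroup E] [Module ℝ E] [TopologicalSpace E]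

/-- `C` has the `σ(E, Z)`-approximate fixed point property, for a subspace `Z` of the
topological dual of `E`: every continuous `f : C → C` admits a sequence `(xₙ)` in `C` with
`φ (xₙ - f xₙ) → 0` for all `φ ∈ Z`. -/
def SetHasAFPP (Z : Submodule ℝ (StrongDual ℝ E)) (C : Set E) : Prop :=
  ∀ f : C → C, Continuous f →
    ∃ x : ℕ → C, ∀ φ ∈ Z,
      Tendsto (fun n => φ ((x n : E) - (f (x n) : E))) atTop (𝓝 0)

/-- `E` has the `σ(E, Z)`-AFPP: every nonempty bounded closed convex subset of `E` has it. -/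
def HasAFPP (Z : Submodule ℝ (StrongDual ℝ E)) : Prop :=
  ∀ C : Set E, C.Nonempty → Bornology.IsVonNBounded ℝ C → IsClosed C → Convex ℝ C →
    SetHasAFPP E Z C

/-- The weak-AFPP is the `σ(E, E*)`-AFPP. -/
def HasWeakAFPP : Prop := HasAFPP E ⊤

end TVS

/-- A topology `τ` on the normed space `X` that is a locally convex vector space topology and is
compatible with the duality `⟨X, X*⟩`, i.e. the `τ`-continuous linear functionals on `X` are
exactly the norm-continuous ones (`UniformSpace.toTopologicalSpace` is the norm topology of `X`). -/
structure IsCompatibleLC (X : Type*) [NormedAddCommGroup X] [NormedSpace ℝ X]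
    (τ : TopologicalSpace X) : Prop where
  isTopologicalAddGroup : @IsTopologicalAddGroup X τ _
  continuousSMul : @ContinuousSMul ℝ X _ _ τ
  locallyConvexSpace : @LocallyConvexSpace ℝ X _ _ _ _ τ
  continuous_iff : ∀ φ : X →ₗ[ℝ] ℝ,
    @Continuous X ℝ τ _ φ ↔ @Continuous X ℝ (UniformSpace.toTopologicalSpace) _ φ

/-- Asplund spaces (for a Banach space `E`): every continuous convex function on an open convex
subset `U` of `E` is Fréchet differentiable at each point of some dense `Gδ` subset of `U`. -/
def IsAsplund (E : Type*) [NormedAddCommGroup E] [NormedSpace ℝ E] : Prop :=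
  ∀ (U : Set E) (f : E → ℝ), IsOpen U → ConvexOn ℝ U f → ContinuousOn f U →
    ∃ G ⊆ U, IsGδ G ∧ U ⊆ closure G ∧ ∀ x ∈ G, DifferentiableAt ℝ f x

/-- A topological space has a countable network: a countable family `N` of (not necessarily
open) subsets such that every open set is a union of members of `N`. -/
def HasCountableNetwork (T : Type*) [TopologicalSpace T] : Prop :=
  ∃ N : Set (Set T), N.Countable ∧
    ∀ (U : Set T) (t : T), IsOpen U → t ∈ U → ∃ A ∈ N, t ∈ A ∧ A ⊆ U

/-- `ℵ₀`-monolithic spaces: each separable subset has a countable network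
(both in the subspace topology). -/
def IsAlephZeroMonolithic (T : Type*) [TopologicalSpace T] : Prop :=
  ∀ S : Set T, TopologicalSpace.SeparableSpace S → HasCountableNetwork S

end AFPP

/-!
The proof has two independent halves: approximate fixed points for finitely many functionals, and
the passage from finite families of functionals to a single sequence.

*Finitely many functionals.* Given a continuous self-map `f` of a bounded convex set `C` and
functionals `φ₁, …, φₙ`, the image of `C` in `ℝⁿ` is totally bounded. A finite net of it, lifted
to points `vⱼ` of `C`, and a subordinate partition of unity turn `f` into a self-map of the simplex
spanned by the `vⱼ`, and a nearly fixed point of the latter gives `x` with all `φᵢ (x - f x)` small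
(`exists_approx_fixedPoint_of_finite`). Nearly fixed points on a simplex
(`exists_approx_fixedPoint_stdSimplex`) are obtained from Scarf's lemma on families of rankings
of a finite set (`exists_isPrimitive_image_eq_univ`), applied to the points of a fine grid ranked by
their coordinates. Thus `0` is in the `σ(E, Z)`-closure of the set of all `x - f x`.

*Asplund spaces.* The weak topology of a normed space is countably tight, so `0` is already in the
weak closure of countably many vectors `x - f x`. Their span in the completion of `X` is separable,
and a separable subspace `Y` of an Asplund space has a separable dual: otherwise the dual ball of
`Y` contains a weak* compact set without small nonempty relatively open subsets
(`exists_compact_no_small_open`); a minimal weak* compact set of functionals on the whole space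
that restricts onto it has a small slice, given by Fréchet differentiability of its support function
(`AFPP.IsAsplund.exists_small_slice`), and by minimality the restrictions of that slice contain a
nonempty relatively open set. Countably many functionals therefore suffice to test weak convergence
of bounded sequences to `0`. Only the duality enters, not the topology `τ` itself.

*Monolithic duals.* Here a point of `C` generates a norm-separable `f`-invariant convex set, so that
again countably many vectors `x - f x` have `0` in their `σ(X*, X)`-closure. The weak* closure of
these vectors is compact and separable, hence has a countable network, and each member of
the network contributes at most one point of `X`. The resulting sequence in `X` distinguishes `0`
from all other elements of the closure, and by compactness it tests convergence to `0`
(`AFPP.IsAlephZeroMonolithic.exists_null_seq`).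
-/

/-! ### Scarf's combinatorial lemma -/

section Scarf

variable {V I : Type*}

/-- A finite set `B` is *primitive* for a family `r i` of rankings of `V` if every `y : V` is,
in at least one of the rankings, weakly below all elements of `B`. -/
def IsPrimitive (r : I → V → ℕ) (B : Finset V) : Prop :=
  ∀ y, ∃ i, ∀ x ∈ B, r i y ≤ r i x

theorem IsPrimitive.mono {r : I → V → ℕ} {B D : Finset V} (hB : IsPrimitive r B) (h : D ⊆ B) :
    IsPrimitive r D := fun y =>
  let ⟨i, hi⟩ := hB y
  ⟨i, fun x hx => hi x (h hx)⟩

variable [Fintype V] [DecidableEq V] [Fintype I] [DecidableEq I]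

/-- The replacement step: a primitive set with one element less than there are rankings, and
which is not extremal in the sense of `hext`, extends by one element to a primitive set in
exactly two ways. -/
theorem IsPrimitive.exists_two_extensions {r : I → V → ℕ} (hr : ∀ i, Function.Injective (r i))
    {D : Finset V} (hD : IsPrimitive r D) (hne : D.Nonempty)
    (hcard : D.card + 1 = Fintype.card I)
    (hext : ∀ j, ∃ y, ∀ i, i ≠ j → ∃ x ∈ D, r i x < r i y) :
    ∃ a b, a ≠ b ∧ a ∉ D ∧ b ∉ D ∧
      ∀ y, y ∉ D → (IsPrimitive r (insert y D) ↔ y = a ∨ y = b) := by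
  classical
  choose m hmD hm using fun i => D.exists_min_image (r i) hne
  have hsurj : ∀ x ∈ D, ∃ i, m i = x := fun x hx => by
    obtain ⟨i, hi⟩ := hD x
    exact ⟨i, hr i (le_antisymm (hm i x hx) (hi _ (hmD i)))⟩
  obtain ⟨j, -, k, -, hjk, hmjk⟩ := Finset.exists_ne_map_eq_of_card_lt_of_maps_to
    (s := (Finset.univ : Finset I)) (t := D) (f := m) (by rw [Finset.card_univ]; omega)
    (fun i _ => hmD i)
  -- The minimum map `m` identifies `j` and `k`, and no other two indices.
  have hinj : ∀ p, p = j ∨ p = k → ∀ i l, i ≠ p → l ≠ p → m i = m l → i = l := by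
    intro p hp i l hi hl
    have h1 : Set.SurjOn m (Finset.univ.erase p : Finset I) D := by
      intro x hx
      obtain ⟨i, rfl⟩ := hsurj x hx
      by_cases hip : i = p
      · rcases hp with rfl | rfl
        · exact ⟨k, by simp [hjk.symm], by rw [hip, hmjk]⟩
        · exact ⟨j, by simp [hjk], by rw [hip, hmjk]⟩
      · exact ⟨i, by simp [hip], rfl⟩
    have h2 := Finset.injOn_of_surjOn_of_card_le (s := Finset.univ.erase p) (t := D) m
      (fun i _ => hmD i) h1
      (by rw [Finset.card_erase_of_mem (Finset.mem_univ _), Finset.card_univ]; omega)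
    exact fun h => h2 (by simp [hi]) (by simp [hl]) h
  -- A largest element of `V` that beats the minima in all rankings but `p`.
  have key : ∀ p, p = j ∨ p = k → ∃ a, a ∉ D ∧ (∀ i, i ≠ p → r i (m i) < r i a) ∧
      ∀ y, (∀ i, i ≠ p → r i (m i) < r i y) → r p y ≤ r p a := by
    intro p hp
    obtain ⟨y, hy⟩ := hext p
    obtain ⟨a, ha, hamax⟩ := (Finset.univ.filter
      (fun y => ∀ i, i ≠ p → r i (m i) < r i y)).exists_max_image (r p)
      ⟨y, by
        simp only [Finset.mem_filter, Finset.mem_univ, true_and]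
        intro i hi
        obtain ⟨x, hx, hxy⟩ := hy i hi
        exact (hm i x hx).trans_lt hxy⟩
    simp only [Finset.mem_filter, Finset.mem_univ, true_and] at ha hamax
    refine ⟨a, fun haD => ?_, ha, hamax⟩
    obtain ⟨i, rfl⟩ := hsurj a haD
    by_cases hip : i = p
    · rcases hp with rfl | rfl
      · exact (ha k hjk.symm).ne (by rw [hip, hmjk])
      · exact (ha j hjk).ne (by rw [hip, hmjk])
    · exact (ha i hip).false
  have prim : ∀ p a, (∀ i, i ≠ p → r i (m i) < r i a) →
      (∀ y, (∀ i, i ≠ p → r i (m i) < r i y) → r p y ≤ r p a) →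
      IsPrimitive r (insert a D) := by
    intro p a ha hamax y
    have hap : ∀ x ∈ D, r p a ≤ r p x := by
      obtain ⟨i, hi⟩ := hD a
      by_cases hip : i = p
      · exact hip ▸ hi
      · exact absurd (hi _ (hmD i)) (ha i hip).not_ge
    by_cases hy : ∀ i, i ≠ p → r i (m i) < r i y
    · refine ⟨p, fun x hx => (hamax y hy).trans ?_⟩
      rcases Finset.mem_insert.1 hx with rfl | hx
      · exact le_rfl
      · exact hap x hx
    · push Not at hy
      obtain ⟨i, hip, hi⟩ := hy
      refine ⟨i, fun x hx => hi.trans ?_⟩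
      rcases Finset.mem_insert.1 hx with rfl | hx
      · exact (ha i hip).le
      · exact hm i x hx
  have conv : ∀ y, y ∉ D → IsPrimitive r (insert y D) → ∃ p, (p = j ∨ p = k) ∧
      (∀ i, i ≠ p → r i (m i) < r i y) ∧
      ∀ z, (∀ i, i ≠ p → r i (m i) < r i z) → r p z ≤ r p y := by
    intro y hyD hy
    obtain ⟨p, hp⟩ := hy y
    have hidx : ∀ x ∈ D, ∃ i, i ≠ p ∧ m i = x ∧ r i x < r i y := by
      intro x hx
      obtain ⟨i, hi⟩ := hy x
      have hxy : x ≠ y := fun h => hyD (h ▸ hx)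
      refine ⟨i, ?_, hr i (le_antisymm (hm i x hx) (hi _ (Finset.mem_insert_of_mem (hmD i)))),
        lt_of_le_of_ne (hi _ (Finset.mem_insert_self _ _)) (fun h => hxy (hr i h))⟩
      rintro rfl
      exact hxy (hr i (le_antisymm (hi _ (Finset.mem_insert_self _ _))
        (hp x (Finset.mem_insert_of_mem hx))))
    have hpjk : p = j ∨ p = k := by
      by_contra! hcon
      obtain ⟨i, hip, hi, -⟩ := hidx (m p) (hmD p)
      by_cases hij : i = j
      · exact hip (hinj k (Or.inr rfl) i p (hij ▸ hjk) hcon.2 hi)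
      · exact hip (hinj j (Or.inl rfl) i p hij hcon.1 hi)
    have hlt : ∀ i, i ≠ p → r i (m i) < r i y := by
      intro i hip
      obtain ⟨l, hlp, hl, hly⟩ := hidx (m i) (hmD i)
      obtain rfl := hinj p hpjk l i hlp hip hl
      exact hly
    refine ⟨p, hpjk, hlt, fun z hz => ?_⟩
    obtain ⟨l, hl⟩ := hy z
    by_cases hlp : l = p
    · subst hlp
      exact hl y (Finset.mem_insert_self _ _)
    · exact absurd (hl _ (Finset.mem_insert_of_mem (hmD l))) (hz l hlp).not_ge
  obtain ⟨a, haD, ha, hamax⟩ := key j (Or.inl rfl)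
  obtain ⟨b, hbD, hb, hbmax⟩ := key k (Or.inr rfl)
  refine ⟨a, b, ?_, haD, hbD, fun y hyD => ⟨fun hy => ?_, ?_⟩⟩
  · rintro rfl
    obtain ⟨l, hl⟩ := hD a
    by_cases hlj : l = j
    · exact (hb l (hlj ▸ hjk)).not_ge (hl _ (hmD l))
    · exact (ha l hlj).not_ge (hl _ (hmD l))
  · obtain ⟨p, rfl | rfl, h1, h2⟩ := conv y hyD hy
    · exact Or.inl (hr p (le_antisymm (hamax y h1) (h2 a ha)))
    · exact Or.inr (hr p (le_antisymm (hbmax y h1) (h2 b hb)))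
  · rintro (rfl | rfl)
    · exact prim j _ ha hamax
    · exact prim k _ hb hbmax

/-- If a colouring of `B` misses some colour, then an even number of the sets `D ⊆ B` with one
element less carry all colours but `i₀`. -/
theorem even_card_facets_of_image_ne_univ (c : V → I) (i₀ : I) {B : Finset V}
    (hB : B.card = Fintype.card I) (hc : B.image c ≠ Finset.univ) :
    Even (Finset.card {D : Finset V | (D.card + 1 = Fintype.card I ∧
      D.image c = Finset.univ.erase i₀) ∧ D ⊆ B}) := by
  classical
  rcases Finset.eq_empty_or_nonempty ({D : Finset V | (D.card + 1 = Fintype.card I ∧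
      D.image c = Finset.univ.erase i₀) ∧ D ⊆ B} : Finset (Finset V)) with h | ⟨D, hD⟩
  · rw [h]; simp
  simp only [Finset.mem_filter, Finset.mem_univ, true_and] at hD
  obtain ⟨⟨hDc, hDi⟩, hDB⟩ := hD
  have hinj : Set.InjOn c D := by
    rw [← Finset.card_image_iff, hDi, Finset.card_erase_of_mem (Finset.mem_univ _),
      Finset.card_univ]
    omega
  obtain ⟨x, hxD, rfl⟩ := (Finset.covBy_iff_exists_insert (s := D) (t := B)).1
    (Finset.covBy_iff_card_sdiff_eq_one.2 ⟨hDB, by rw [Finset.card_sdiff_of_subset hDB]; omega⟩)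
  have hcx : c x ≠ i₀ := by
    intro h
    apply hc
    rw [Finset.image_insert, hDi, h, Finset.insert_erase (Finset.mem_univ _)]
  obtain ⟨x', hx'D, hx'⟩ : ∃ x' ∈ D, c x' = c x := by
    have : c x ∈ D.image c := by rw [hDi]; simp [hcx]
    simpa using this
  have hxx' : x ≠ x' := fun h => hxD (h ▸ hx'D)
  suffices ({E : Finset V | (E.card + 1 = Fintype.card I ∧
      E.image c = Finset.univ.erase i₀) ∧ E ⊆ insert x D} : Finset (Finset V)) =
      {(insert x D).erase x, (insert x D).erase x'} by
    rw [this, Finset.card_pair]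
    · exact even_two
    · intro h
      have : x ∈ (insert x D).erase x' := by simp [hxx']
      rw [← h] at this
      simp at this
  ext E
  simp only [Finset.mem_filter, Finset.mem_univ, true_and, Finset.mem_insert,
    Finset.mem_singleton]
  constructor
  · rintro ⟨⟨hEc, hEi⟩, hEB⟩
    obtain ⟨z, hz, hzE⟩ := Finset.exists_of_ssubset (hEB.ssubset_of_ne (by
      intro h; rw [h] at hEc; omega))
    have hE : E = (insert x D).erase z := by
      refine Finset.eq_of_subset_of_card_le (fun w hw => Finset.mem_erase.2
        ⟨fun h => hzE (h ▸ hw), hEB hw⟩) ?_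
      rw [Finset.card_erase_of_mem hz]; omega
    subst hE
    by_cases hzx : z = x
    · left; rw [hzx]
    right
    have hzD : z ∈ D := by simpa [hzx] using hz
    have hcz : c z ≠ i₀ := by
      have : c z ∈ D.image c := Finset.mem_image_of_mem c hzD
      rw [hDi] at this
      exact (Finset.mem_erase.1 this).1
    have : c z ∈ ((insert x D).erase z).image c := by rw [hEi]; simp [hcz]
    obtain ⟨w, hw, hwz⟩ := Finset.mem_image.1 this
    obtain ⟨hwz', hw⟩ := Finset.mem_erase.1 hw
    rcases Finset.mem_insert.1 hw with rfl | hw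
    · rw [hinj hzD hx'D (by rw [hx', hwz])]
    · exact absurd (hinj hw hzD hwz) hwz'
  · have h1 : (insert x D).erase x = D := Finset.erase_insert hxD
    rintro (rfl | rfl)
    · rw [h1]; exact ⟨⟨hDc, hDi⟩, hDB⟩
    · have h2 : (insert x D).erase x' = insert x (D.erase x') :=
        Finset.erase_insert_of_ne hxx'
      refine ⟨⟨?_, ?_⟩, Finset.erase_subset _ _⟩
      · rw [Finset.card_erase_of_mem (by simp [hx'D]), Finset.card_insert_of_notMem hxD]
        omega
      · rw [h2, Finset.image_insert, ← hx', ← Finset.image_insert, Finset.insert_erase hx'D, hDi]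

/-- **Scarf's lemma.** The slack elements `s i` are lowest in the ranking `i` and above all
other elements in the other rankings. If `s i` has the colour `i`, there is a primitive set that
carries every colour exactly once. -/
theorem exists_isPrimitive_image_eq_univ {r : I → V → ℕ} (hr : ∀ i, Function.Injective (r i))
    {s : I → V} (hlow : ∀ i v, v ≠ s i → r i (s i) < r i v)
    (hhigh : ∀ i k, i ≠ k → ∀ t, t ∉ Set.range s → r i t < r i (s k))
    (hT : ∃ t, t ∉ Set.range s) [Nonempty I] {c : V → I} (hc : ∀ i, c (s i) = i) :
    ∃ B : Finset V, B.card = Fintype.card I ∧ IsPrimitive r B ∧ B.image c = Finset.univ := by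
  classical
  by_contra! hcon
  obtain ⟨i₀⟩ := ‹Nonempty I›
  have hsinj : Function.Injective s := fun i k h => by rw [← hc i, ← hc k, h]
  -- `R` consists of the rooms, `W` of the doors, and a door `D` opens into a room `B` if `D ⊆ B`.
  -- Incident pairs of a door and a room are counted modulo 2 in two ways.
  set R : Finset (Finset V) := {B | B.card = Fintype.card I ∧ IsPrimitive r B} with hRdef
  set W : Finset (Finset V) := {D | D.card + 1 = Fintype.card I ∧
    D.image c = Finset.univ.erase i₀} with hWdef
  have hsum := Finset.sum_card_bipartiteAbove_eq_sum_card_bipartiteBelow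
    (s := W) (t := R) (fun D B => D ⊆ B)
  -- As no room carries all colours, each room has an even number of doors.
  have hroom : Even (∑ B ∈ R, (Finset.bipartiteBelow (fun D B => D ⊆ B) W B).card) := by
    refine Finset.even_sum _ fun B hB => ?_
    simp only [hRdef, Finset.mem_filter, Finset.mem_univ, true_and] at hB
    have := even_card_facets_of_image_ne_univ c i₀ hB.1 (hcon B hB.1 hB.2)
    rwa [Finset.bipartiteBelow, hWdef, Finset.filter_filter]
  set D₀ : Finset V := (Finset.univ.erase i₀).image s with hD₀
  have hmemD₀ : ∀ i, i ≠ i₀ → s i ∈ D₀ := fun i hi => by simp [hD₀, hi, hsinj.eq_iff]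
  have hD₀W : D₀ ∈ W := by
    simp only [hWdef, Finset.mem_filter, Finset.mem_univ, true_and]
    refine ⟨?_, ?_⟩
    · rw [hD₀, Finset.card_image_of_injective _ hsinj,
        Finset.card_erase_of_mem (Finset.mem_univ _), Finset.card_univ]
      have := Fintype.card_pos_iff.2 ⟨i₀⟩
      omega
    · rw [hD₀, Finset.image_image, show c ∘ s = id from funext hc, Finset.image_id]
  -- The door made of all slack elements but `s i₀` opens into one room only.
  have hbd : (Finset.bipartiteAbove (fun D B => D ⊆ B) R D₀).card = 1 := by
    obtain ⟨t₀, ht₀⟩ := hT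
    obtain ⟨t, ht, htmax⟩ := (Finset.univ.filter (fun t => t ∉ Set.range s)).exists_max_image
      (r i₀) ⟨t₀, by simpa using ht₀⟩
    replace ht : t ∉ Set.range s := (Finset.mem_filter.1 ht).2
    replace htmax : ∀ v, v ∉ Set.range s → r i₀ v ≤ r i₀ t :=
      fun v hv => htmax v (Finset.mem_filter.2 ⟨Finset.mem_univ _, hv⟩)
    have htD : t ∉ D₀ := by
      rw [hD₀, Finset.mem_image]
      rintro ⟨i, -, rfl⟩
      exact ht ⟨i, rfl⟩
    have hcard : D₀.card + 1 = Fintype.card I := (Finset.mem_filter.1 hD₀W).2.1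
    rw [Finset.card_eq_one]
    refine ⟨insert t D₀, ?_⟩
    ext B
    simp only [Finset.bipartiteAbove, hRdef, Finset.mem_filter, Finset.mem_univ, true_and,
      Finset.mem_singleton]
    constructor
    · rintro ⟨⟨hBc, hB⟩, hDB⟩
      obtain ⟨y, hyD, rfl⟩ := (Finset.covBy_iff_exists_insert (s := D₀) (t := B)).1
        (Finset.covBy_iff_card_sdiff_eq_one.2
          ⟨hDB, by rw [Finset.card_sdiff_of_subset hDB]; omega⟩)
      obtain ⟨i, hi⟩ := hB t
      have hii : i = i₀ := by
        by_contra hne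
        exact (hi _ (Finset.mem_insert_of_mem (hmemD₀ i hne))).not_gt
          (hlow i t fun h => ht ⟨i, h.symm⟩)
      subst hii
      have hty := hi y (Finset.mem_insert_self _ _)
      have hyT : y ∉ Set.range s := by
        rintro ⟨k, rfl⟩
        by_cases hk : k = i
        · subst hk
          exact hty.not_gt (hlow k t fun h => ht ⟨k, h.symm⟩)
        · exact hyD (hmemD₀ k hk)
      rw [hr i (le_antisymm hty (htmax y hyT))]
    · rintro rfl
      refine ⟨⟨by rw [Finset.card_insert_of_notMem htD, hcard], fun y => ?_⟩,
        Finset.subset_insert _ _⟩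
      by_cases hy : y ∈ Set.range s
      · obtain ⟨i, rfl⟩ := hy
        refine ⟨i, fun x _ => ?_⟩
        by_cases hx : x = s i
        · rw [hx]
        · exact (hlow i x hx).le
      · refine ⟨i₀, fun x hx => ?_⟩
        rcases Finset.mem_insert.1 hx with rfl | hx
        · exact htmax y hy
        · obtain ⟨k, hk, rfl⟩ := Finset.mem_image.1 hx
          exact (hhigh i₀ k (Finset.ne_of_mem_erase hk).symm y hy).le
  -- Every other door opens into none or two.
  have hdoor : ∀ D ∈ W.erase D₀,
      Even (Finset.bipartiteAbove (fun D B => D ⊆ B) R D).card := by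
    intro D hD
    obtain ⟨hDD₀, hDW⟩ := Finset.mem_erase.1 hD
    simp only [hWdef, Finset.mem_filter, Finset.mem_univ, true_and] at hDW
    obtain ⟨hDc, hDi⟩ := hDW
    rcases Finset.eq_empty_or_nonempty (Finset.bipartiteAbove (fun D B => D ⊆ B) R D)
      with h | ⟨B, hB⟩
    · rw [h]; simp
    have hDprim : IsPrimitive r D := by
      simp only [Finset.bipartiteAbove, hRdef, Finset.mem_filter, Finset.mem_univ,
        true_and] at hB
      exact hB.1.2.mono hB.2
    obtain ⟨t, htD, ht⟩ : ∃ t ∈ D, t ∉ Set.range s := by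
      by_contra! hall
      apply hDD₀
      have h1 : D = (D.image c).image s := by
        rw [Finset.image_image]
        ext v
        simp only [Finset.mem_image, Function.comp_apply]
        constructor
        · intro hv
          obtain ⟨i, rfl⟩ := hall v hv
          exact ⟨s i, hv, by rw [hc]⟩
        · rintro ⟨w, hw, rfl⟩
          obtain ⟨i, rfl⟩ := hall w hw
          rwa [hc]
      rw [h1, hDi]
    obtain ⟨a, b, hab, haD, hbD, hiff⟩ := hDprim.exists_two_extensions hr ⟨t, htD⟩ hDc
      (fun j => ⟨s j, fun i hi => ⟨t, htD, hhigh i j hi t ht⟩⟩)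
    suffices Finset.bipartiteAbove (fun D B => D ⊆ B) R D = {insert a D, insert b D} by
      rw [this, Finset.card_pair]
      · exact even_two
      · intro h
        have : a ∈ insert b D := h ▸ Finset.mem_insert_self a D
        simp [hab, haD] at this
    ext B
    simp only [Finset.bipartiteAbove, hRdef, Finset.mem_filter, Finset.mem_univ, true_and,
      Finset.mem_insert, Finset.mem_singleton]
    constructor
    · rintro ⟨⟨hBc, hB⟩, hDB⟩
      obtain ⟨y, hyD, rfl⟩ := (Finset.covBy_iff_exists_insert (s := D) (t := B)).1
        (Finset.covBy_iff_card_sdiff_eq_one.2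
          ⟨hDB, by rw [Finset.card_sdiff_of_subset hDB]; omega⟩)
      rcases (hiff y hyD).1 hB with rfl | rfl
      · exact Or.inl rfl
      · exact Or.inr rfl
    · rintro (rfl | rfl)
      · exact ⟨⟨by rw [Finset.card_insert_of_notMem haD, hDc], (hiff a haD).2 (Or.inl rfl)⟩,
          Finset.subset_insert _ _⟩
      · exact ⟨⟨by rw [Finset.card_insert_of_notMem hbD, hDc], (hiff b hbD).2 (Or.inr rfl)⟩,
          Finset.subset_insert _ _⟩
  rw [← Finset.add_sum_erase _ _ hD₀W, hbd] at hsum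
  have := Finset.even_sum _ hdoor
  rw [← hsum] at hroom
  exact (Nat.not_even_iff_odd.2 (this.one_add)) hroom

end Scarf

/-! ### Approximate fixed points on a simplex -/

section Brouwer

variable {ι : Type*} [Fintype ι]

/-- Scarf's lemma with the slack elements eliminated: `T` is a finite set with rankings `r i`,
and `c` is a colouring. -/
theorem exists_dominating_colours [DecidableEq ι] [Nonempty ι] {T : Type*} [Fintype T]
    [DecidableEq T] [Nonempty T] {r : ι → T → ℕ} (hr : ∀ i, Function.Injective (r i)) (c : T → ι) :
    ∃ (A : Finset T) (J : Finset ι), (∀ i ∈ J, ∃ x ∈ A, c x = i) ∧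
      ∀ y, ∃ i ∈ J, ∀ x ∈ A, r i y ≤ r i x := by
  obtain ⟨M, hM⟩ : ∃ M, ∀ i t, r i t < M := by
    refine ⟨(Finset.univ.sup fun p : ι × T => r p.1 p.2) + 1, fun i t => Nat.lt_succ_of_le ?_⟩
    exact Finset.le_sup (f := fun p : ι × T => r p.1 p.2) (Finset.mem_univ (i, t))
  let e := Fintype.equivFin ι
  let r' : ι → T ⊕ ι → ℕ := fun i => Sum.elim (fun t => r i t + 1)
    (fun k => if k = i then 0 else M + 1 + e k)
  have hinj : ∀ i, Function.Injective (r' i) := by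
    rintro i (t | k) (t' | k') h
    · simp only [r', Sum.elim_inl, add_left_inj] at h
      rw [hr i h]
    · simp only [r', Sum.elim_inl, Sum.elim_inr] at h
      have := hM i t
      split_ifs at h
      omega
    · simp only [r', Sum.elim_inl, Sum.elim_inr] at h
      have := hM i t'
      split_ifs at h
      omega
    · simp only [r', Sum.elim_inr] at h
      split_ifs at h with h1 h2
      · rw [h1, h2]
      · omega
      · omega
      · rw [e.injective (a₁ := k) (a₂ := k') (Fin.ext (by omega))]
  have hlow : ∀ i v, v ≠ Sum.inr i → r' i (Sum.inr i) < r' i v := by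
    rintro i (t | k) hv
    · simp [r']
    · have : k ≠ i := fun h => hv (by rw [h])
      simp [r', this]
  have hhigh : ∀ i k, i ≠ k → ∀ t, t ∉ Set.range (Sum.inr : ι → T ⊕ ι) →
      r' i t < r' i (Sum.inr k) := by
    rintro i k hik (t | l) ht
    · have := hM i t
      simp only [r', Sum.elim_inl, Sum.elim_inr, hik.symm, if_false]
      omega
    · exact absurd ⟨l, rfl⟩ ht
  obtain ⟨B, -, hB, hBc⟩ := exists_isPrimitive_image_eq_univ (r := r') (s := Sum.inr)
    (c := Sum.elim c id) hinj hlow hhigh ⟨Sum.inl (Classical.arbitrary T), by simp⟩ (by simp)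
  refine ⟨Finset.univ.filter (fun t => Sum.inl t ∈ B),
    Finset.univ.filter (fun i => Sum.inr i ∉ B), fun i hi => ?_, fun y => ?_⟩
  · have : i ∈ B.image (Sum.elim c id) := hBc ▸ Finset.mem_univ i
    obtain ⟨x | k, hx, rfl⟩ := Finset.mem_image.1 this
    · exact ⟨x, by simpa using hx, rfl⟩
    · simp at hi; exact absurd hx hi
  · obtain ⟨i, hi⟩ := hB (Sum.inl y)
    refine ⟨i, ?_, fun x hx => ?_⟩
    · simp only [Finset.mem_filter, Finset.mem_univ, true_and]
      intro h
      have := hi _ h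
      simp [r'] at this
    · have := hi (Sum.inl x) (by simpa using hx)
      simpa [r'] using this

/-- **Brouwer's theorem** on the standard simplex, in approximate form. -/
theorem exists_approx_fixedPoint_stdSimplex [Nonempty ι] {F : (ι → ℝ) → ι → ℝ}
    (hF : ContinuousOn F (stdSimplex ℝ ι)) (hmaps : Set.MapsTo F (stdSimplex ℝ ι) (stdSimplex ℝ ι))
    {δ : ℝ} (hδ : 0 < δ) : ∃ t ∈ stdSimplex ℝ ι, ∀ i, |F t i - t i| < δ := by
  classical
  set n : ℝ := (Fintype.card ι : ℝ) with hn
  have hn1 : 1 ≤ n := by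
    rw [hn]; exact_mod_cast Fintype.card_pos
  set ε : ℝ := δ / (4 * n) with hε
  have hεpos : 0 < ε := by positivity
  obtain ⟨η, hη, huc⟩ := Metric.uniformContinuousOn_iff.1
    ((isCompact_stdSimplex ℝ ι).uniformContinuousOn_of_continuous hF) ε hεpos
  obtain ⟨N, hN⟩ := exists_nat_gt (n / min η ε)
  have hmin : 0 < min η ε := lt_min hη hεpos
  have hNpos : (0 : ℝ) < N := lt_of_le_of_lt (by positivity) hN
  have hnN : n / N < min η ε := by
    rw [div_lt_iff₀ hmin] at hN
    rw [div_lt_iff₀ hNpos]; linarith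
  -- The grid points of mesh `1 / N` in the simplex, multiplied by `N`.
  let T := {k : ι → Fin (N + 1) // ∑ i, (k i : ℕ) = N}
  let p : T → ι → ℝ := fun x i => (x.1 i : ℕ) / (N : ℝ)
  have hp : ∀ x, p x ∈ stdSimplex ℝ ι := by
    intro x
    refine ⟨fun i => by positivity, ?_⟩
    simp only [p]
    rw [← Finset.sum_div, ← Nat.cast_sum, x.2, div_self hNpos.ne']
  have hle : ∀ k : ι → ℕ, ∑ i, k i = N → ∃ x : T, ∀ i, (x.1 i : ℕ) = k i := by
    intro k hk
    have : ∀ i, k i < N + 1 := fun i => Nat.lt_succ_of_le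
      (hk ▸ Finset.single_le_sum (f := k) (fun _ _ => Nat.zero_le _) (Finset.mem_univ i))
    exact ⟨⟨fun i => ⟨k i, this i⟩, hk⟩, fun i => rfl⟩
  have hTne : Nonempty T := by
    obtain ⟨x, -⟩ := hle (Pi.single (Classical.arbitrary ι) N) (by simp)
    exact ⟨x⟩
  -- A point receives as colour a coordinate which `F` does not decrease.
  have hcol : ∀ x : T, ∃ i, p x i ≤ F (p x) i := by
    intro x
    by_contra! h
    have := Finset.sum_lt_sum_of_nonempty (s := Finset.univ) Finset.univ_nonempty (fun i _ => h i)
    rw [(hp x).2, (hmaps (hp x)).2] at this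
    exact this.false
  choose c hc using hcol
  let e := Fintype.equivFin T
  -- The points are ranked by their coordinates, with ties broken by a fixed enumeration.
  let r : ι → T → ℕ := fun i x => Fintype.card T * (x.1 i : ℕ) + e x
  have hrle : ∀ i x y, r i x ≤ r i y → (x.1 i : ℕ) ≤ y.1 i := by
    intro i x y h
    by_contra! hlt
    have h1 : Fintype.card T * ((y.1 i : ℕ) + 1) ≤ Fintype.card T * (x.1 i : ℕ) :=
      Nat.mul_le_mul_left _ hlt
    have h2 := (e y).2
    simp only [r] at h
    rw [mul_add] at h1
    omega
  have hrinj : ∀ i, Function.Injective (r i) := by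
    intro i x y h
    have h1 := le_antisymm (hrle i x y h.le) (hrle i y x h.ge)
    simp only [r, h1] at h
    exact e.injective (Fin.ext (by omega))
  obtain ⟨A, J, hAJ, hdom⟩ := exists_dominating_colours hrinj c
  obtain ⟨z, hzA⟩ : A.Nonempty := by
    obtain ⟨i, hi, -⟩ := hdom (Classical.arbitrary T)
    obtain ⟨x, hx, -⟩ := hAJ i hi
    exact ⟨x, hx⟩
  -- The minima of the coordinates in `J` over `A`.
  choose m hmA hm using fun i => A.exists_min_image (fun x => (x.1 i : ℕ)) ⟨z, hzA⟩
  let a : ι → ℕ := fun i => if i ∈ J then ((m i).1 i : ℕ) else 0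
  have hax : ∀ x ∈ A, ∀ i, a i ≤ x.1 i := by
    intro x hx i
    simp only [a]
    split_ifs
    · exact hm i x hx
    · exact Nat.zero_le _
  have hasum : N < ∑ i, a i + Fintype.card ι := by
    by_contra! hcon
    -- Otherwise a grid point lies strictly above all these minima.
    have hJ : ∑ i, (if i ∈ J then a i + 1 else 0) ≤ N := by
      refine le_trans (Finset.sum_le_sum (g := fun i => a i + 1) fun i _ => ?_) ?_
      · split_ifs <;> omega
      · rw [Finset.sum_add_distrib]; simpa using hcon
    obtain ⟨j, hj, -⟩ := hdom z
    obtain ⟨y, hy⟩ := hle (fun i => (if i ∈ J then a i + 1 else 0) +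
      Pi.single (M := fun _ => ℕ) j (N - ∑ i, (if i ∈ J then a i + 1 else 0)) i) (by
        rw [Finset.sum_add_distrib]
        simp only [Finset.sum_pi_single', Finset.mem_univ, if_true]
        omega)
    obtain ⟨i, hi, hiy⟩ := hdom y
    have h1 := hrle _ _ _ (hiy _ (hmA i))
    have h2 := hy i
    simp only [hi, if_true, a] at h2
    omega
  have hup : ∀ x ∈ A, ∀ i, (x.1 i : ℕ) ≤ a i + Fintype.card ι := by
    intro x hx i
    have h1 : ∑ k, (x.1 k : ℕ) = N := x.2
    rw [← Finset.add_sum_erase _ _ (Finset.mem_univ i)] at h1 hasum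
    have h2 : ∑ k ∈ Finset.univ.erase i, a k ≤ ∑ k ∈ Finset.univ.erase i, (x.1 k : ℕ) :=
      Finset.sum_le_sum fun k _ => hax x hx k
    omega
  have hlow' : ∀ x ∈ A, ∀ i, (a i : ℝ) / N ≤ p x i := fun x hx i => by
    simp only [p]; gcongr; exact hax x hx i
  have hup' : ∀ x ∈ A, ∀ i, p x i ≤ (a i : ℝ) / N + n / N := fun x hx i => by
    simp only [p]
    rw [← add_div]; gcongr
    rw [hn]; exact_mod_cast hup x hx i
  have hclose : ∀ x ∈ A, dist (F (p x)) (F (p z)) < ε := by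
    intro x hx
    refine huc _ (hp x) _ (hp z) (lt_of_le_of_lt ?_ (hnN.trans_le (min_le_left _ _)))
    rw [dist_pi_le_iff (by positivity)]
    intro i
    rw [Real.dist_eq, abs_le]
    constructor <;> linarith [hlow' x hx i, hup' x hx i, hlow' z hzA i, hup' z hzA i]
  have hFz : ∀ i, (a i : ℝ) / N - ε ≤ F (p z) i := by
    intro i
    by_cases hi : i ∈ J
    · obtain ⟨x, hx, rfl⟩ := hAJ i hi
      have h1 := (dist_le_pi_dist _ _ (c x)).trans (hclose x hx).le
      rw [Real.dist_eq] at h1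
      linarith [(abs_le.1 h1).2, hc x, hlow' x hx (c x)]
    · have : a i = 0 := by simp [a, hi]
      rw [this]
      have := (hmaps (hp z)).1 i
      simp only [Nat.cast_zero, zero_div, zero_sub]
      linarith
  have hnN' : n / N < ε := hnN.trans_le (min_le_right _ _)
  have hdiff : ∀ i, -(2 * ε) < F (p z) i - p z i := fun i => by
    linarith [hFz i, hup' z hzA i]
  have hnε : n * (2 * ε) = δ / 2 := by
    rw [hε]; field_simp; norm_num
  refine ⟨p z, hp z, fun i => abs_lt.2 ⟨?_, ?_⟩⟩
  · nlinarith [hdiff i]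
  · have h0 : ∑ k, (F (p z) k - p z k) = 0 := by
      rw [Finset.sum_sub_distrib, (hp z).2, (hmaps (hp z)).2, sub_self]
    rw [← Finset.add_sum_erase _ _ (Finset.mem_univ i)] at h0
    have h1 : ∑ k ∈ Finset.univ.erase i, (-(2 * ε)) ≤
        ∑ k ∈ Finset.univ.erase i, (F (p z) k - p z k) :=
      Finset.sum_le_sum fun k _ => (hdiff k).le
    rw [Finset.sum_const, Finset.card_erase_of_mem (Finset.mem_univ _), Finset.card_univ,
      nsmul_eq_mul, Nat.cast_sub Fintype.card_pos, Nat.cast_one, ← hn] at h1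
    nlinarith

end Brouwer

/-! ### Approximate fixed points for finitely many functionals -/

section FiniteFunctionals

/-- Finitely many functionals cannot detect that a continuous self-map of a bounded convex set
moves all points: a finite net of the image of `C` and a subordinate partition of unity reduce
this to a self-map of a simplex. -/
theorem exists_approx_fixedPoint_of_finite {E : Type*} [AddCommGroup E] [Module ℝ E]
    [TopologicalSpace E] [IsTopologicalAddGroup E] [ContinuousSMul ℝ E] {C : Set E}
    (hne : C.Nonempty) (hb : Bornology.IsVonNBounded ℝ C) (hconv : Convex ℝ C) {f : E → E}
    (hf : ContinuousOn f C) (hmaps : Set.MapsTo f C C) {ι : Type*} [Fintype ι]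
    (φ : ι → StrongDual ℝ E) {ε : ℝ} (hε : 0 < ε) : ∃ x ∈ C, ∀ i, |φ i (x - f x)| < ε := by
  let Φ : E →L[ℝ] (ι → ℝ) := ContinuousLinearMap.pi φ
  have hbΦ : Bornology.IsBounded (Φ '' C) := (NormedSpace.isVonNBounded_iff ℝ).1 (hb.image Φ)
  have htb : TotallyBounded (Φ '' C) :=
    (Metric.isCompact_of_isClosed_isBounded isClosed_closure hbΦ.closure).totallyBounded.subset
      subset_closure
  obtain ⟨t, htC, htfin, ht⟩ := Metric.finite_approx_of_totallyBounded htb (ε / 2) (by positivity)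
  have := htfin.fintype
  choose v hvC hv using fun j : t => htC j.2
  have htne : Nonempty t := by
    obtain ⟨x, hx⟩ := hne
    obtain ⟨j, hj, -⟩ := Set.mem_iUnion₂.1 (ht ⟨x, hx, rfl⟩)
    exact ⟨⟨j, hj⟩⟩
  let μ : t → (ι → ℝ) → ℝ := fun j y => max 0 (ε / 2 - dist y j)
  let lam : (ι → ℝ) → t → ℝ := fun y j => μ j y / ∑ k, μ k y
  have hμ : ∀ j y, 0 ≤ μ j y := fun j y => le_max_left _ _
  have hμc : ∀ j, Continuous (μ j) := fun j => by fun_prop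
  have hpos : ∀ y ∈ Φ '' C, 0 < ∑ k, μ k y := by
    intro y hy
    obtain ⟨j, hj, hyj⟩ := Set.mem_iUnion₂.1 (ht hy)
    refine Finset.sum_pos' (fun k _ => hμ k y) ⟨⟨j, hj⟩, Finset.mem_univ _, ?_⟩
    exact lt_max_of_lt_right (sub_pos.2 hyj)
  have hlam : ∀ y ∈ Φ '' C, lam y ∈ stdSimplex ℝ t := fun y hy =>
    ⟨fun j => div_nonneg (hμ j y) (hpos y hy).le, by
      simp only [lam]; rw [← Finset.sum_div, div_self (hpos y hy).ne']⟩
  have hlamc : ContinuousOn lam (Φ '' C) :=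
    continuousOn_pi.2 fun j => (hμc j).continuousOn.div
      (continuous_finsetSum _ fun k _ => hμc k).continuousOn fun y hy => (hpos y hy).ne'
  have hbary : ∀ y ∈ Φ '' C, ‖∑ j, lam y j • Φ (v j) - y‖ ≤ ε / 2 := by
    intro y hy
    have h1 : ∑ j, lam y j • Φ (v j) - y = ∑ j, lam y j • (Φ (v j) - y) := by
      simp only [smul_sub, Finset.sum_sub_distrib]
      rw [← Finset.sum_smul, (hlam y hy).2, one_smul]
    rw [h1]
    calc ‖∑ j, lam y j • (Φ (v j) - y)‖ ≤ ∑ j, ‖lam y j • (Φ (v j) - y)‖ := norm_sum_le _ _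
      _ ≤ ∑ j, lam y j * (ε / 2) := by
          refine Finset.sum_le_sum fun j _ => ?_
          rw [norm_smul, Real.norm_of_nonneg ((hlam y hy).1 j)]
          by_cases hj : dist y j < ε / 2
          · refine mul_le_mul_of_nonneg_left ?_ ((hlam y hy).1 j)
            rw [hv, ← dist_eq_norm, dist_comm]
            exact hj.le
          · have : lam y j = 0 := by
              simp only [lam, μ]
              rw [max_eq_left (by linarith), zero_div]
            rw [this]; simp
      _ = ε / 2 := by rw [← Finset.sum_mul, (hlam y hy).2, one_mul]
  let s : (t → ℝ) → E := fun w => ∑ j, w j • v j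
  have hs : ∀ w ∈ stdSimplex ℝ t, s w ∈ C := fun w hw =>
    hconv.sum_mem (fun j _ => hw.1 j) hw.2 fun j _ => hvC j
  have hsc : Continuous s := by fun_prop
  set δ : ℝ := ε / 2 / (∑ j, ‖Φ (v j)‖ + 1) with hδ
  have hsum : 0 ≤ ∑ j, ‖Φ (v j)‖ := Finset.sum_nonneg fun _ _ => norm_nonneg _
  obtain ⟨w, hw, hwδ⟩ := exists_approx_fixedPoint_stdSimplex
    (F := fun w => lam (Φ (f (s w))))
    (hlamc.comp (Φ.continuous.comp_continuousOn (hf.comp hsc.continuousOn hs))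
      fun w hw => ⟨_, hmaps (hs w hw), rfl⟩)
    (fun w hw => hlam _ ⟨_, hmaps (hs w hw), rfl⟩) (δ := δ) (by positivity)
  refine ⟨s w, hs w hw, fun i => ?_⟩
  have hsplit : Φ (s w - f (s w)) = ∑ j, (w j - lam (Φ (f (s w))) j) • Φ (v j) +
      (∑ j, lam (Φ (f (s w))) j • Φ (v j) - Φ (f (s w))) := by
    simp only [sub_smul, Finset.sum_sub_distrib, s, map_sub, map_sum, map_smul]
    abel
  have h1 : ‖∑ j, (w j - lam (Φ (f (s w))) j) • Φ (v j)‖ ≤ δ * ∑ j, ‖Φ (v j)‖ := by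
    rw [Finset.mul_sum]
    refine (norm_sum_le _ _).trans (Finset.sum_le_sum fun j _ => ?_)
    rw [norm_smul, Real.norm_eq_abs, abs_sub_comm]
    exact mul_le_mul_of_nonneg_right (hwδ j).le (norm_nonneg _)
  have h2 : δ * ∑ j, ‖Φ (v j)‖ < ε / 2 := by
    rw [hδ, div_mul_eq_mul_div, div_lt_iff₀ (by positivity)]
    nlinarith
  have h3 : ‖Φ (s w - f (s w))‖ < ε := by
    rw [hsplit]
    have := hbary _ ⟨_, hmaps (hs w hw), rfl⟩
    linarith [norm_add_le (∑ j, (w j - lam (Φ (f (s w))) j) • Φ (v j))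
      (∑ j, lam (Φ (f (s w))) j • Φ (v j) - Φ (f (s w)))]
  exact (norm_le_pi_norm (Φ (s w - f (s w))) i).trans_lt h3

end FiniteFunctionals

/-! ### Separable subspaces of Asplund spaces have separable duals -/

section Asplund

open TopologicalSpace WeakDual

/-- Among the compact sets that a continuous map sends onto a given set there is a minimal one. -/
theorem exists_minimal_compact_image {A B : Type*} [TopologicalSpace A] [T2Space A]
    [TopologicalSpace B] [T1Space B] {R : A → B} (hR : Continuous R) {K₁ : Set A}
    (hK₁ : IsCompact K₁) {L : Set B} (hL : L ⊆ R '' K₁) :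
    ∃ K ⊆ K₁, IsCompact K ∧ L ⊆ R '' K ∧ ∀ K₂ ⊆ K, IsCompact K₂ → L ⊆ R '' K₂ → K₂ = K := by
  obtain ⟨K, hK, hmin⟩ := zorn_superset {K : Set A | IsCompact K ∧ K ⊆ K₁ ∧ L ⊆ R '' K} (by
    intro c hc hchain
    rcases c.eq_empty_or_nonempty with rfl | hne
    · exact ⟨K₁, ⟨hK₁, subset_rfl, hL⟩, by simp⟩
    obtain ⟨K₀, hK₀⟩ := hne
    refine ⟨⋂₀ c, ⟨(hc hK₀).1.of_isClosed_subset (isClosed_sInter fun K hK => (hc hK).1.isClosed)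
      (Set.sInter_subset_of_mem hK₀), (Set.sInter_subset_of_mem hK₀).trans (hc hK₀).2.1, ?_⟩,
      fun K hK => Set.sInter_subset_of_mem hK⟩
    intro y hy
    have : Nonempty c := ⟨⟨K₀, hK₀⟩⟩
    have hcl : IsClosed (R ⁻¹' {y}) := isClosed_singleton.preimage hR
    obtain ⟨x, hx⟩ := IsCompact.nonempty_iInter_of_directed_nonempty_isCompact_isClosed
      (fun K : c => (K : Set A) ∩ R ⁻¹' {y})
      (by
        rintro ⟨K, hK⟩ ⟨K', hK'⟩
        rcases hchain.total hK hK' with h | h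
        · exact ⟨⟨K, hK⟩, subset_rfl, Set.inter_subset_inter_left _ h⟩
        · exact ⟨⟨K', hK'⟩, Set.inter_subset_inter_left _ h, subset_rfl⟩)
      (fun K => by
        obtain ⟨x, hx, hxy⟩ := (hc K.2).2.2 hy
        exact ⟨x, hx, hxy⟩)
      (fun K => (hc K.2).1.inter_right hcl)
      (fun K => (hc K.2).1.isClosed.inter hcl)
    rw [Set.mem_iInter] at hx
    exact ⟨x, fun K hK => (hx ⟨K, hK⟩).1, (hx ⟨K₀, hK₀⟩).2⟩)
  exact ⟨K, hK.2.1, hK.1, hK.2.2, fun K₂ hK₂ hc hL₂ =>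
    hK₂.antisymm (hmin ⟨hc, hK₂.trans hK.2.1, hL₂⟩ hK₂)⟩

/-- In the dual of an Asplund space, bounded weak* compact sets have nonempty relatively weak*
open subsets of arbitrarily small diameter, namely the slices at a point of Fréchet
differentiability of the support function. -/
theorem AFPP.IsAsplund.exists_small_slice {E : Type*} [NormedAddCommGroup E] [NormedSpace ℝ E]
    (hE : AFPP.IsAsplund E) {K : Set (WeakDual ℝ E)} (hK : IsCompact K) (hne : K.Nonempty)
    (hball : ∀ a ∈ K, ‖toStrongDual a‖ ≤ 1) {ε : ℝ} (hε : 0 < ε) :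
    ∃ W : Set (WeakDual ℝ E), IsOpen W ∧ (W ∩ K).Nonempty ∧
      ∃ ψ : StrongDual ℝ E, ∀ a ∈ W ∩ K, ‖toStrongDual a - ψ‖ ≤ ε := by
  let p : E → ℝ := fun x => sSup ((fun a : WeakDual ℝ E => a x) '' K)
  have hev : ∀ x : E, Continuous fun a : WeakDual ℝ E => a x := fun x => eval_continuous x
  have hatt : ∀ x, ∃ a ∈ K, p x = a x := fun x =>
    hK.exists_sSup_image_eq hne (hev x).continuousOn
  have hle : ∀ x, ∀ a ∈ K, a x ≤ p x := fun x a ha =>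
    le_csSup (hK.image (hev x)).bddAbove ⟨a, ha, rfl⟩
  have hconv : ConvexOn ℝ Set.univ p := by
    refine ⟨convex_univ, fun x _ y _ s t hs ht _ => ?_⟩
    obtain ⟨a, ha, hpa⟩ := hatt (s • x + t • y)
    rw [hpa, map_add, map_smul, map_smul, smul_eq_mul, smul_eq_mul]
    exact add_le_add (mul_le_mul_of_nonneg_left (hle x a ha) hs)
      (mul_le_mul_of_nonneg_left (hle y a ha) ht)
  have hlip : LipschitzWith 1 p := LipschitzWith.of_le_add fun x y => by
    obtain ⟨a, ha, hpa⟩ := hatt x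
    have h1 : a x - a y ≤ ‖x - y‖ := by
      rw [← map_sub]
      refine (le_abs_self _).trans (((toStrongDual a).le_opNorm (x - y)).trans ?_)
      exact (mul_le_mul_of_nonneg_right (hball a ha) (norm_nonneg _)).trans_eq (one_mul _)
    rw [hpa, dist_eq_norm]
    linarith [hle y a ha]
  obtain ⟨G, -, -, hG, hdiff⟩ := hE Set.univ p isOpen_univ hconv hlip.continuous.continuousOn
  obtain ⟨x, hx⟩ : G.Nonempty := closure_nonempty_iff.1 ⟨0, hG (Set.mem_univ _)⟩
  obtain ⟨ψ, hψ⟩ := hdiff x hx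
  have hη : 0 < ε / 2 := by positivity
  obtain ⟨δ, hδ, hδψ⟩ := Metric.eventually_nhds_iff_ball.1
    ((hasFDerivAt_iff_isLittleO_nhds_zero.1 hψ).def hη)
  obtain ⟨a₀, ha₀, hpa₀⟩ := hatt x
  refine ⟨{a | p x - ε / 2 * (δ / 2) < a x}, isOpen_lt continuous_const (hev x),
    ⟨a₀, ?_, ha₀⟩, ψ, ?_⟩
  · simp only [Set.mem_ofPred_eq, ← hpa₀]
    have : 0 < ε / 2 * (δ / 2) := by positivity
    linarith
  · rintro a ⟨ha, haK⟩
    have hkey : ∀ h : E, ‖h‖ = δ / 2 → (toStrongDual a - ψ) h ≤ ε * (δ / 2) := by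
      intro h hh
      have h1 := hδψ h (by rw [mem_ball_zero_iff, hh]; linarith)
      rw [hh, Real.norm_eq_abs] at h1
      have h2 := hle (x + h) a haK
      rw [map_add] at h2
      have h3 : p x - ε / 2 * (δ / 2) < a x := ha
      rw [sub_apply, toStrongDual_apply]
      linarith [(abs_le.1 h1).2]
    refine ContinuousLinearMap.opNorm_le_of_unit_norm hε.le fun u hu => ?_
    have hδ2 : 0 < δ / 2 := by positivity
    have h1 := hkey ((δ / 2) • u) (by rw [norm_smul, hu, Real.norm_of_nonneg hδ2.le, mul_one])
    have h2 := hkey (-((δ / 2) • u))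
      (by rw [norm_neg, norm_smul, hu, Real.norm_of_nonneg hδ2.le, mul_one])
    rw [map_neg, map_smul, smul_eq_mul] at h2
    rw [map_smul, smul_eq_mul] at h1
    rw [Real.norm_eq_abs, abs_le]
    constructor <;> nlinarith

/-- If the dual unit ball of a separable space is not covered by countably many norm balls of
radius `ε`, it contains a nonempty weak* compact set no nonempty relatively weak* open subset of
which fits into such a ball. It remains when all relatively open subsets that have a countable
cover are removed. -/
theorem exists_compact_no_small_open {Y : Type*} [NormedAddCommGroup Y] [NormedSpace ℝ Y]
    [SeparableSpace Y] {ε : ℝ} (h : ¬ ∃ F : Set (StrongDual ℝ Y), F.Countable ∧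
      ∀ a : StrongDual ℝ Y, ‖a‖ ≤ 1 → ∃ φ ∈ F, ‖a - φ‖ ≤ ε) :
    ∃ L : Set (WeakDual ℝ Y), IsCompact L ∧ L.Nonempty ∧ (∀ a ∈ L, ‖toStrongDual a‖ ≤ 1) ∧
      ∀ U : Set (WeakDual ℝ Y), IsOpen U → (U ∩ L).Nonempty → ∀ ψ : StrongDual ℝ Y,
        ∃ a ∈ U ∩ L, ε < ‖toStrongDual a - ψ‖ := by
  let Covered : Set (WeakDual ℝ Y) → Prop := fun A =>
    ∃ F : Set (StrongDual ℝ Y), F.Countable ∧ ∀ a ∈ A, ∃ φ ∈ F, ‖toStrongDual a - φ‖ ≤ ε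
  let L₁ : Set (WeakDual ℝ Y) := toStrongDual ⁻¹' Metric.closedBall 0 1
  have hL₁ : IsCompact L₁ := isCompact_closedBall 0 1
  have hmem : ∀ a, a ∈ L₁ ↔ ‖toStrongDual a‖ ≤ 1 := fun a => mem_closedBall_zero_iff
  have hnot : ¬ Covered L₁ := fun ⟨F, hF, hcov⟩ =>
    h ⟨F, hF, fun a ha => hcov (StrongDual.toWeakDual a) ((hmem _).2 ha)⟩
  let O : Set (WeakDual ℝ Y) := ⋃₀ {U | IsOpen U ∧ Covered (U ∩ L₁)}
  have hO : IsOpen O := isOpen_sUnion fun U hU => hU.1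
  have hOcov : Covered (O ∩ L₁) := by
    have : MetrizableSpace L₁ := metrizable_of_isCompact ℝ Y L₁ hL₁
    have : CompactSpace L₁ := isCompact_iff_compactSpace.1 hL₁
    have : SecondCountableTopology L₁ := by
      let := metrizableSpaceMetric L₁
      infer_instance
    have hex : ∀ a : L₁, ∃ U : Set (WeakDual ℝ Y), (a : WeakDual ℝ Y) ∈ O →
        (IsOpen U ∧ (a : WeakDual ℝ Y) ∈ U ∧ Covered (U ∩ L₁)) := by
      intro a
      by_cases ha : (a : WeakDual ℝ Y) ∈ O
      · obtain ⟨U, hU, haU⟩ := ha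
        exact ⟨U, fun _ => ⟨hU.1, haU, hU.2⟩⟩
      · exact ⟨∅, fun h => absurd h ha⟩
    choose U hU using hex
    obtain ⟨t, htO, htc, ht⟩ := countable_cover_nhdsWithin
      (f := fun a : L₁ => ((↑) : L₁ → WeakDual ℝ Y) ⁻¹' U a)
      (s := ((↑) : L₁ → WeakDual ℝ Y) ⁻¹' O) fun a ha => mem_nhdsWithin_of_mem_nhds
        (((hU a ha).1.preimage continuous_subtype_val).mem_nhds (hU a ha).2.1)
    choose! F hFc hF using fun (a : L₁) (ha : (a : WeakDual ℝ Y) ∈ O) => (hU a ha).2.2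
    refine ⟨⋃ a ∈ t, F a, htc.biUnion fun a ha => hFc a (htO ha), ?_⟩
    rintro a ⟨haO, haL⟩
    obtain ⟨b, hb, hab⟩ := Set.mem_iUnion₂.1 (ht (show (⟨a, haL⟩ : L₁) ∈ _ from haO))
    obtain ⟨φ, hφ, hle⟩ := hF b (htO hb) a ⟨hab, haL⟩
    exact ⟨φ, Set.mem_biUnion hb hφ, hle⟩
  refine ⟨L₁ \ O, hL₁.diff hO, ?_, fun a ha => (hmem a).1 ha.1, fun U hU hne ψ => ?_⟩
  · by_contra hemp
    rw [Set.not_nonempty_iff_eq_empty, Set.sdiff_eq_empty] at hemp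
    exact hnot (by rwa [Set.inter_eq_right.2 hemp] at hOcov)
  · by_contra! hcon
    obtain ⟨a, haU, haL, haO⟩ := hne
    obtain ⟨F, hF, hFcov⟩ := hOcov
    refine haO ⟨U, ⟨hU, insert ψ F, hF.insert ψ, ?_⟩, haU⟩
    rintro b ⟨hbU, hbL⟩
    by_cases hbO : b ∈ O
    · obtain ⟨φ, hφ, hle⟩ := hFcov b ⟨hbO, hbL⟩
      exact ⟨φ, Set.mem_insert_of_mem _ hφ, hle⟩
    · exact ⟨ψ, Set.mem_insert _ _, hcon b ⟨hbU, hbL, hbO⟩⟩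

/-- The dual unit ball of a separable subspace `Y` of an Asplund space is norm separable: a weak*
compact set without small relatively open subsets in the dual of `Y` would lift to a minimal weak*
compact set in the dual of `E`, and a small slice of the latter projects onto a set with nonempty
relative interior in the former. -/
theorem AFPP.IsAsplund.exists_countable_cover_dual {E : Type*} [NormedAddCommGroup E] [NormedSpace ℝ E]
    (hE : AFPP.IsAsplund E) (Y : Submodule ℝ E) [SeparableSpace Y] {ε : ℝ} (hε : 0 < ε) :
    ∃ F : Set (StrongDual ℝ Y), F.Countable ∧
      ∀ a : StrongDual ℝ Y, ‖a‖ ≤ 1 → ∃ φ ∈ F, ‖a - φ‖ ≤ ε := by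
  by_contra hcon
  obtain ⟨L, hL, ⟨b₀, hb₀⟩, hLball, hLbig⟩ := exists_compact_no_small_open hcon
  let R : WeakDual ℝ E → WeakDual ℝ Y := fun a =>
    StrongDual.toWeakDual ((toStrongDual a).comp Y.subtypeL)
  have hR : Continuous R := continuous_of_continuous_eval fun y => eval_continuous (y : E)
  let K₁ : Set (WeakDual ℝ E) := toStrongDual ⁻¹' Metric.closedBall 0 1
  have hLK₁ : L ⊆ R '' K₁ := by
    intro b hb
    obtain ⟨g, hg, hgn⟩ := exists_extension_norm_eq Y (toStrongDual b)
    refine ⟨StrongDual.toWeakDual g, mem_closedBall_zero_iff.2 ?_, ?_⟩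
    · exact hgn.trans_le (hLball b hb)
    · exact DFunLike.ext _ _ hg
  -- Intersecting with the preimage of `L` makes `L` the exact image.
  obtain ⟨K, hKK₁, hK, hLK, hKmin⟩ := exists_minimal_compact_image hR
    ((isCompact_closedBall (𝕜 := ℝ) (0 : StrongDual ℝ E) 1).inter_right
      (hL.isClosed.preimage hR)) (L := L) (by
        intro b hb
        obtain ⟨a, ha, rfl⟩ := hLK₁ hb
        exact ⟨a, ⟨ha, hb⟩, rfl⟩)
  obtain ⟨a₀, ha₀, -⟩ := hLK hb₀
  obtain ⟨W, hW, ⟨w, hwW, hwK⟩, ψ, hψ⟩ := hE.exists_small_slice hK ⟨a₀, ha₀⟩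
    (fun a ha => mem_closedBall_zero_iff.1 (hKK₁ ha).1) hε
  have hcl : IsCompact (R '' (K \ W)) := (hK.diff hW).image hR
  obtain ⟨b, hb, hbR⟩ : ∃ b ∈ L, b ∉ R '' (K \ W) := by
    by_contra! hall
    have := hKmin _ Set.sdiff_subset (hK.diff hW) hall
    rw [← this] at hwK
    exact hwK.2 hwW
  obtain ⟨c, ⟨hcU, hcL⟩, hc⟩ := hLbig _ hcl.isClosed.isOpen_compl ⟨b, hbR, hb⟩
    (ψ.comp Y.subtypeL)
  obtain ⟨a, haK, rfl⟩ := hLK hcL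
  have haW : a ∈ W := by
    by_contra h
    exact hcU ⟨a, ⟨haK, h⟩, rfl⟩
  refine hc.not_ge (le_trans ?_ (hψ a ⟨haW, haK⟩))
  have : toStrongDual (R a) - ψ.comp Y.subtypeL = (toStrongDual a - ψ).comp Y.subtypeL := rfl
  rw [this]
  refine (ContinuousLinearMap.opNorm_comp_le _ _).trans ?_
  exact mul_le_of_le_one_right (norm_nonneg _) Y.norm_subtypeL_le

end Asplund

/-! ### Weakly null sequences in Asplund spaces -/

section WeaklyNull

open TopologicalSpace WeakDual

variable {E : Type*} [NormedAddCommGroup E] [NormedSpace ℝ E]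

/-- The weak topology of a normed space is countably tight (Kaplansky): if `0` is in the weak
closure of `S`, it is in the weak closure of a countable subset. For each `n`, compactness of a
power of a dual ball produces finitely many points of `S` that serve all families of functionals
of norm at most `n`. -/
theorem exists_countable_weak_closure {S : Set E}
    (hS : ∀ (φ : ℕ → StrongDual ℝ E) (n : ℕ) (ε : ℝ), 0 < ε → ∃ x ∈ S, ∀ i < n, |φ i x| < ε) :
    ∃ D ⊆ S, D.Countable ∧
      ∀ (φ : ℕ → StrongDual ℝ E) (n : ℕ) (ε : ℝ), 0 < ε → ∃ x ∈ D, ∀ i < n, |φ i x| < ε := by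
  have hfin : ∀ n : ℕ, ∃ t : Finset S, ∀ φ : ℕ → StrongDual ℝ E, (∀ i, ‖φ i‖ ≤ n) →
      ∃ x ∈ t, ∀ i < n, |φ i (x : E)| < 1 / (n + 1) := by
    intro n
    have hc : IsCompact (Set.univ.pi fun _ : ℕ =>
        (toStrongDual ⁻¹' Metric.closedBall (0 : StrongDual ℝ E) n : Set (WeakDual ℝ E))) :=
      isCompact_univ_pi fun _ => isCompact_closedBall 0 n
    obtain ⟨t, ht⟩ := hc.elim_finite_subcover
      (fun x : S => {φ : ℕ → WeakDual ℝ E | ∀ i ∈ Finset.range n, |φ i (x : E)| < 1 / (n + 1)})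
      (fun x => by
        simp only [Set.ofPred_forall]
        refine isOpen_biInter_finset fun i _ => isOpen_lt ?_ continuous_const
        exact ((eval_continuous (x : E)).comp (continuous_apply i)).abs)
      (fun φ _ => by
        obtain ⟨x, hx, hφ⟩ := hS (fun i => toStrongDual (φ i)) n (1 / (n + 1)) (by positivity)
        exact Set.mem_iUnion.2 ⟨⟨x, hx⟩, fun i hi => hφ i (Finset.mem_range.1 hi)⟩)
    refine ⟨t, fun φ hφ => ?_⟩
    obtain ⟨x, hx, h⟩ := Set.mem_iUnion₂.1
      (ht (show (fun i => StrongDual.toWeakDual (φ i)) ∈ _ from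
        fun i _ => mem_closedBall_zero_iff.2 (hφ i)))
    exact ⟨x, hx, fun i hi => h i (Finset.mem_range.2 hi)⟩
  choose t ht using hfin
  refine ⟨⋃ n, (↑) '' (t n : Set S), ?_, ?_, fun φ n ε hε => ?_⟩
  · refine Set.iUnion_subset fun n => ?_
    rintro _ ⟨x, -, rfl⟩
    exact x.2
  · exact Set.countable_iUnion fun n => (t n).countable_toSet.image _
  · obtain ⟨N₁, hN₁⟩ := exists_nat_one_div_lt hε
    obtain ⟨N₂, hN₂⟩ := exists_nat_ge (∑ i ∈ Finset.range n, ‖φ i‖)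
    set N := max n (max N₁ N₂) with hN
    obtain ⟨x, hx, hφ⟩ := ht N (fun i => if i < n then φ i else 0) (fun i => by
      split_ifs with hi
      · calc ‖φ i‖ ≤ ∑ i ∈ Finset.range n, ‖φ i‖ :=
            Finset.single_le_sum (f := fun i => ‖φ i‖) (fun _ _ => norm_nonneg _)
              (Finset.mem_range.2 hi)
          _ ≤ N₂ := hN₂
          _ ≤ N := by exact_mod_cast (le_max_right _ _).trans (le_max_right _ _)
      · simp)
    refine ⟨x, Set.mem_iUnion.2 ⟨N, x, hx, rfl⟩, fun i hi => ?_⟩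
    have h1 := hφ i (hi.trans_le (le_max_left _ _))
    rw [if_pos hi] at h1
    refine (h1.trans_le ?_).trans hN₁
    have : (N₁ : ℝ) ≤ N := by exact_mod_cast (le_max_left _ _).trans (le_max_right _ _)
    gcongr

/-- In an Asplund space, a bounded set with `0` in its weak closure contains a weakly null
sequence: the dual of the span of a suitable countable subset is separable. -/
theorem AFPP.IsAsplund.exists_weakly_null_seq (hE : AFPP.IsAsplund E) {S : Set E} {M : ℝ}
    (hM : ∀ x ∈ S, ‖x‖ ≤ M)
    (hS : ∀ (φ : ℕ → StrongDual ℝ E) (n : ℕ) (ε : ℝ), 0 < ε → ∃ x ∈ S, ∀ i < n, |φ i x| < ε) :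
    ∃ u : ℕ → E, (∀ n, u n ∈ S) ∧
      ∀ φ : StrongDual ℝ E, Tendsto (fun n => φ (u n)) atTop (𝓝 0) := by
  obtain ⟨D, hDS, hDc, hD⟩ := exists_countable_weak_closure hS
  let Y : Submodule ℝ E := Submodule.span ℝ D
  have : SeparableSpace Y := hDc.isSeparable.span.separableSpace
  choose F hFc hF using fun k : ℕ => hE.exists_countable_cover_dual Y
    (ε := 1 / ((k : ℝ) + 1)) (by positivity)
  obtain ⟨ψ, hψ⟩ := (Set.countable_iUnion hFc).exists_eq_range
    (by obtain ⟨φ, hφ, -⟩ := hF 0 0 (ContinuousLinearMap.opNorm_zero.trans_le zero_le_one); exact ⟨φ, Set.mem_iUnion.2 ⟨0, hφ⟩⟩)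
  choose g hg _ using fun i => exists_extension_norm_eq Y (ψ i)
  choose u huD hu using fun n : ℕ => hD g n (1 / ((n : ℝ) + 1)) (by positivity)
  have hlim : ∀ i, Tendsto (fun n => g i (u n)) atTop (𝓝 0) := by
    intro i
    refine squeeze_zero_norm' ?_ tendsto_one_div_add_atTop_nhds_zero_nat
    filter_upwards [eventually_gt_atTop i] with n hn
    exact (hu n i hn).le
  have hM0 : 0 ≤ M := (norm_nonneg _).trans (hM _ (hDS (huD 0)))
  have hunit : ∀ φ : StrongDual ℝ E, ‖φ‖ ≤ 1 → Tendsto (fun n => φ (u n)) atTop (𝓝 0) := by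
    intro φ hφ
    rw [Metric.tendsto_atTop]
    intro ε hε
    obtain ⟨k, hk⟩ := exists_nat_one_div_lt (show 0 < ε / 2 / (M + 1) by positivity)
    obtain ⟨χ, hχ, hle⟩ := hF k (φ.comp Y.subtypeL)
      ((ContinuousLinearMap.opNorm_comp_le _ _).trans
        (mul_le_one₀ hφ (norm_nonneg _) Y.norm_subtypeL_le))
    obtain ⟨i, rfl⟩ : χ ∈ Set.range ψ := hψ ▸ Set.mem_iUnion.2 ⟨k, hχ⟩
    obtain ⟨N, hN⟩ := Metric.tendsto_atTop.1 (hlim i) (ε / 2) (by positivity)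
    refine ⟨N, fun n hn => ?_⟩
    have h1 := hN n hn
    rw [Real.dist_eq, sub_zero] at h1 ⊢
    let y : Y := ⟨u n, Submodule.subset_span (huD n)⟩
    have h2 : |φ (u n) - g i (u n)| ≤ ε / 2 / (M + 1) * M := by
      have h3 := (φ.comp Y.subtypeL - ψ i).le_opNorm y
      have h4 : (φ.comp Y.subtypeL - ψ i) y = φ (u n) - g i (u n) := by
        rw [sub_apply, ← hg i y]; rfl
      rw [h4, Real.norm_eq_abs] at h3
      exact h3.trans (mul_le_mul (hle.trans hk.le) (hM _ (hDS (huD n))) (norm_nonneg _)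
        (by positivity))
    have h5 : ε / 2 / (M + 1) * M ≤ ε / 2 := by
      rw [div_mul_eq_mul_div, div_le_iff₀ (by positivity)]
      nlinarith
    calc |φ (u n)| = |(φ (u n) - g i (u n)) + g i (u n)| := by rw [sub_add_cancel]
      _ ≤ |φ (u n) - g i (u n)| + |g i (u n)| := abs_add_le _ _
      _ < ε := by linarith
  refine ⟨u, fun n => hDS (huD n), fun φ => ?_⟩
  have hpos : 0 < ‖φ‖ + 1 := by positivity
  have h1 := (hunit ((‖φ‖ + 1)⁻¹ • φ) (by
    rw [norm_smul, norm_inv, Real.norm_of_nonneg hpos.le, inv_mul_le_iff₀ hpos]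
    linarith)).const_mul (‖φ‖ + 1)
  simpa [mul_inv_cancel_left₀ hpos.ne'] using h1

/-- Weakly bounded sets are norm bounded. -/
theorem exists_norm_le_of_forall_dual_bounded {S : Set E}
    (h : ∀ φ : StrongDual ℝ E, ∃ B : ℝ, ∀ x ∈ S, |φ x| ≤ B) : ∃ M : ℝ, ∀ x ∈ S, ‖x‖ ≤ M := by
  obtain ⟨M, hM⟩ := banach_steinhaus
    (g := fun x : S => NormedSpace.inclusionInDoubleDual ℝ E (x : E)) fun φ => by
      obtain ⟨B, hB⟩ := h φ
      exact ⟨B, fun x => hB x x.2⟩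
  refine ⟨M, fun x hx => ?_⟩
  have := hM ⟨x, hx⟩
  rwa [show ‖NormedSpace.inclusionInDoubleDual ℝ E x‖ = ‖x‖ from
    (NormedSpace.inclusionInDoubleDualLi ℝ).norm_map x] at this

end WeaklyNull

/-! ### Weak* null sequences in monolithic duals -/

section Monolithic

open TopologicalSpace WeakDual

theorem TopologicalSpace.IsSeparable.image_of_continuousOn {A B : Type*} [PseudoMetricSpace A]
    [TopologicalSpace B] {s : Set A} (hs : IsSeparable s) {f : A → B} (hf : ContinuousOn f s) :
    IsSeparable (f '' s) := by
  have := hs.separableSpace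
  rw [← Set.range_domRestrict]
  exact isSeparable_range (continuousOn_iff_continuous_domRestrict.1 hf)

/-- A continuous self-map of a bounded convex subset of a normed space admits a countable set of
points among which it has approximate fixed points for all finite families of functionals. A
point generates a norm-separable convex set invariant under the map. -/
theorem exists_countable_approx_fixedPoints {E : Type*} [NormedAddCommGroup E] [NormedSpace ℝ E]
    {C : Set E} (hne : C.Nonempty) (hb : Bornology.IsBounded C) (hconv : Convex ℝ C) {f : E → E}
    (hf : ContinuousOn f C) (hmaps : Set.MapsTo f C C) :
    ∃ D ⊆ C, D.Countable ∧ ∀ (φ : ℕ → StrongDual ℝ E) (n : ℕ) (ε : ℝ), 0 < ε →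
      ∃ x ∈ D, ∀ i < n, |φ i (x - f x)| < ε := by
  obtain ⟨x₀, hx₀⟩ := hne
  let A : ℕ → Set E := fun n => Nat.rec {x₀} (fun _ B => convexHull ℝ (B ∪ f '' B)) n
  have hAsucc : ∀ n, A (n + 1) = convexHull ℝ (A n ∪ f '' A n) := fun n => rfl
  have hAC : ∀ n, A n ⊆ C := by
    intro n
    induction n with
    | zero => exact Set.singleton_subset_iff.2 hx₀
    | succ n ih =>
      rw [hAsucc]
      exact convexHull_min (Set.union_subset ih ((Set.image_mono ih).trans hmaps.image_subset))
        hconv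
  have hmono : Monotone A := monotone_nat_of_le_succ fun n => by
    rw [hAsucc]
    exact Set.subset_union_left.trans (subset_convexHull ℝ _)
  have hAconv : ∀ n, Convex ℝ (A n) := by
    intro n
    cases n with
    | zero => exact convex_singleton x₀
    | succ n => exact convex_convexHull ℝ _
  have hAsep : ∀ n, IsSeparable (A n) := by
    intro n
    induction n with
    | zero => exact (Set.countable_singleton x₀).isSeparable
    | succ n ih =>
      have himg : IsSeparable (f '' A n) := ih.image_of_continuousOn (hf.mono (hAC n))
      exact (ih.union himg).span.mono (convexHull_min Submodule.subset_span
        (Submodule.convex _))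
  set S : Set E := ⋃ n, A n with hSdef
  have hSC : S ⊆ C := Set.iUnion_subset hAC
  have hSmaps : Set.MapsTo f S S := by
    intro x hx
    obtain ⟨n, hn⟩ := Set.mem_iUnion.1 hx
    refine Set.mem_iUnion.2 ⟨n + 1, ?_⟩
    rw [hAsucc]
    exact subset_convexHull ℝ _ (Or.inr ⟨x, hn, rfl⟩)
  have hSconv : Convex ℝ S := hmono.directed_le.convex_iUnion hAconv
  have hSne : S.Nonempty := ⟨x₀, Set.mem_iUnion.2 ⟨0, rfl⟩⟩
  obtain ⟨D, hDS, hDc, hD⟩ := (IsSeparable.iUnion hAsep).exists_countable_dense_subset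
  refine ⟨D, hDS.trans hSC, hDc, fun φ n ε hε => ?_⟩
  obtain ⟨x, hx, hxε⟩ := exists_approx_fixedPoint_of_finite hSne
    ((NormedSpace.isVonNBounded_iff ℝ).2 (hb.subset hSC)) hSconv (hf.mono hSC) hSmaps
    (fun i : Fin n => φ i) hε
  have hev : ∀ᶠ y in 𝓝[S] x, ∀ i : Fin n, |φ i (y - f y)| < ε := by
    refine eventually_all.2 fun i => ?_
    have hcont : ContinuousWithinAt (fun y => |φ i (y - f y)|) S x :=
      ((φ i).continuous.continuousAt.comp_continuousWithinAt
        (continuousWithinAt_id.sub ((hf.mono hSC) x hx))).abs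
    exact hcont.eventually_lt_const (hxε i)
  have : (𝓝[D] x).NeBot := mem_closure_iff_nhdsWithin_neBot.1 (hD hx)
  obtain ⟨y, hy, hyD⟩ := ((hev.filter_mono (nhdsWithin_mono x hDS)).and
    self_mem_nhdsWithin).exists
  exact ⟨y, hyD, fun i hi => hy ⟨i, hi⟩⟩

/-- If a set of functionals has a countable network for the weak* topology, countably many
points of `X` distinguish its elements from `0`. -/
theorem exists_seq_separating_zero {X : Type*} [NormedAddCommGroup X] [NormedSpace ℝ X]
    {K : Set (WeakDual ℝ X)} (hK : AFPP.HasCountableNetwork K) :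
    ∃ z : ℕ → X, ∀ k ∈ K, (∀ i, k (z i) = 0) → k = 0 := by
  obtain ⟨N, hN, hnet⟩ := hK
  have hex : ∀ A : Set K, ∃ x : X, (∃ x' : X, ∀ k ∈ A, (k : WeakDual ℝ X) x' ≠ 0) →
      ∀ k ∈ A, (k : WeakDual ℝ X) x ≠ 0 := by
    intro A
    by_cases h : ∃ x' : X, ∀ k ∈ A, (k : WeakDual ℝ X) x' ≠ 0
    · obtain ⟨x, hx⟩ := h
      exact ⟨x, fun _ => hx⟩
    · exact ⟨0, fun h' => absurd h' h⟩
  choose w hw using hex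
  obtain ⟨z, hz⟩ := ((hN.image w).insert 0).exists_eq_range (Set.insert_nonempty _ _)
  refine ⟨z, fun k hk hkz => ?_⟩
  by_contra hne
  obtain ⟨x, hx⟩ : ∃ x, k x ≠ 0 := by
    by_contra! h
    exact hne (DFunLike.ext _ _ h)
  obtain ⟨A, hA, hkA, hsub⟩ := hnet {k' : K | (k' : WeakDual ℝ X) x ≠ 0} ⟨k, hk⟩
    (isOpen_ne_fun ((eval_continuous x).comp continuous_subtype_val) continuous_const) hx
  obtain ⟨i, hi⟩ : w A ∈ Set.range z := hz ▸ Or.inr ⟨A, hA, rfl⟩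
  exact hw A ⟨x, fun k' hk' => hsub hk'⟩ _ hkA (hi ▸ hkz i)

/-- In an `ℵ₀`-monolithic dual, a bounded countable set with `0` in its weak* closure contains a
weak* null sequence: its weak* closure is compact with a countable network, so convergence to `0`
in it is tested on a sequence in `X`. -/
theorem AFPP.IsAlephZeroMonolithic.exists_null_seq {X : Type*} [NormedAddCommGroup X] [NormedSpace ℝ X]
    (hX : AFPP.IsAlephZeroMonolithic (WeakDual ℝ X)) {S : Set (StrongDual ℝ X)}
    (hb : Bornology.IsBounded S) (hSc : S.Countable)
    (hS : ∀ (z : ℕ → X) (n : ℕ) (ε : ℝ), 0 < ε → ∃ a ∈ S, ∀ i < n, |a (z i)| < ε) :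
    ∃ u : ℕ → StrongDual ℝ X, (∀ n, u n ∈ S) ∧
      ∀ x : X, Tendsto (fun n => u n x) atTop (𝓝 0) := by
  let S' : Set (WeakDual ℝ X) := toStrongDual ⁻¹' S
  have hK : IsCompact (closure S') :=
    isCompact_of_bounded_of_closed (isBounded_closure (s := S') hb) isClosed_closure
  have hS'c : S'.Countable := hSc.preimage toStrongDual.injective
  have hsep : SeparableSpace (closure S') := by
    refine ⟨⟨((↑) : closure S' → WeakDual ℝ X) ⁻¹' S',
      hS'c.preimage Subtype.val_injective, ?_⟩⟩
    rw [Subtype.dense_iff]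
    intro a ha
    rwa [Subtype.image_preimage_coe, Set.inter_eq_right.2 subset_closure]
  obtain ⟨z, hz⟩ := exists_seq_separating_zero (hX _ hsep)
  choose u huS hu using fun n : ℕ => hS z n (1 / ((n : ℝ) + 1)) (by positivity)
  have hlim : ∀ i, Tendsto (fun n => u n (z i)) atTop (𝓝 0) := by
    intro i
    refine squeeze_zero_norm' ?_ tendsto_one_div_add_atTop_nhds_zero_nat
    filter_upwards [eventually_gt_atTop i] with n hn
    exact (hu n i hn).le
  have hconv : Tendsto (fun n => StrongDual.toWeakDual (u n)) atTop (𝓝 (0 : WeakDual ℝ X)) := by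
    refine hK.le_nhds_of_unique_clusterPt
      (mem_map.2 (Eventually.of_forall fun n => subset_closure (huS n))) fun k hk hcl => ?_
    refine hz k hk fun i => ?_
    have h1 : MapClusterPt (k (z i)) atTop fun n => u n (z i) :=
      MapClusterPt.continuousAt_comp (f := fun a : WeakDual ℝ X => a (z i))
        (eval_continuous (z i)).continuousAt hcl
    have : (𝓝 (k (z i)) ⊓ 𝓝 0).NeBot := NeBot.mono h1 (inf_le_inf_left _ (hlim i))
    exact eq_of_nhds_neBot this
  exact ⟨u, huS, fun x => ((eval_continuous x).tendsto (0 : WeakDual ℝ X)).comp hconv⟩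

end Monolithic

/-! ### The approximate fixed point property -/

/-- A continuous self-map of a subset, as a map of the whole space. -/
theorem exists_continuousOn_extension_of_selfMap {E : Type*} [TopologicalSpace E] {C : Set E}
    {f : C → C} (hf : Continuous f) :
    ∃ g : E → E, ContinuousOn g C ∧ Set.MapsTo g C C ∧ ∀ x : C, g x = f x := by
  classical
  have hg : ∀ x : C, (fun x : E => if h : x ∈ C then (f ⟨x, h⟩ : E) else x) x = f x := fun x => by
    simp
  refine ⟨fun x => if h : x ∈ C then (f ⟨x, h⟩ : E) else x, ?_, fun x hx => ?_, hg⟩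
  · rw [continuousOn_iff_continuous_domRestrict]
    convert continuous_subtype_val.comp hf using 1
    exact funext hg
  · rw [hg ⟨x, hx⟩]
    exact (f _).2

theorem Bornology.IsVonNBounded.exists_abs_le {E : Type*} [AddCommGroup E] [Module ℝ E]
    [TopologicalSpace E] {C : Set E} (hC : IsVonNBounded ℝ C) (φ : StrongDual ℝ E) :
    ∃ B : ℝ, ∀ x ∈ C, |φ x| ≤ B := by
  obtain ⟨B, hB⟩ := ((NormedSpace.isVonNBounded_iff ℝ).1 (hC.image φ)).exists_norm_le
  exact ⟨B, fun x hx => hB _ ⟨x, hx, rfl⟩⟩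

/-- If the completion of `X` is an Asplund space, a map that has approximate fixed points for each
finite family of functionals has a sequence of them that serves all functionals. Only the dual of
`X` enters, so that this applies to every topology compatible with the duality. -/
theorem AFPP.IsAsplund.exists_approx_fixedPoint_seq {X : Type*} [NormedAddCommGroup X]
    [NormedSpace ℝ X] (hX : AFPP.IsAsplund (UniformSpace.Completion X)) {C : Set X} {g : X → X}
    (hmaps : Set.MapsTo g C C) (hb : ∀ φ : X →ₗ[ℝ] ℝ, Continuous φ → ∃ B : ℝ, ∀ x ∈ C, |φ x| ≤ B)
    (happ : ∀ (n : ℕ) (φ : Fin n → X →ₗ[ℝ] ℝ) (ε : ℝ), (∀ i, Continuous (φ i)) → 0 < ε →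
      ∃ x ∈ C, ∀ i, |φ i (x - g x)| < ε) :
    ∃ x : ℕ → X, (∀ n, x n ∈ C) ∧
      ∀ φ : X →ₗ[ℝ] ℝ, Continuous φ → Tendsto (fun n => φ (x n - g (x n))) atTop (𝓝 0) := by
  obtain ⟨M, hM⟩ := exists_norm_le_of_forall_dual_bounded fun φ : StrongDual ℝ X =>
    hb φ.toLinearMap φ.cont
  let e : X →L[ℝ] UniformSpace.Completion X := UniformSpace.Completion.toComplL
  have he : ∀ x, ‖e x‖ = ‖x‖ := UniformSpace.Completion.norm_coe
  obtain ⟨u, huS, hu⟩ := hX.exists_weakly_null_seq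
    (S := (fun x => e (x - g x)) '' C) (M := M + M) (by
      rintro _ ⟨x, hx, rfl⟩
      rw [he]
      exact (norm_sub_le _ _).trans (add_le_add (hM _ hx) (hM _ (hmaps hx)))) (by
      intro φ n ε hε
      obtain ⟨x, hx, h⟩ := happ n (fun i => ((φ i).comp e).toLinearMap) ε
        (fun i => ((φ i).comp e).cont) hε
      exact ⟨_, ⟨x, hx, rfl⟩, fun i hi => h ⟨i, hi⟩⟩)
  choose x hxC hx using huS
  refine ⟨x, hxC, fun φ hφ => (hu ((⟨φ, hφ⟩ : StrongDual ℝ X).extend e)).congr fun n => ?_⟩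
  rw [← hx n]
  exact ContinuousLinearMap.extend_eq (⟨φ, hφ⟩ : StrongDual ℝ X)
    UniformSpace.Completion.denseRange_coe (UniformSpace.Completion.isUniformInducing_coe X) _

theorem AFPP.IsAsplund.hasWeakAFPP {X : Type*} [NormedAddCommGroup X] [NormedSpace ℝ X]
    (hX : AFPP.IsAsplund (UniformSpace.Completion X)) (τ : TopologicalSpace X)
    (hτ : AFPP.IsCompatibleLC X τ) : @AFPP.HasWeakAFPP X _ _ τ := by
  intro C hne hb _ hconv f hf
  obtain ⟨g, hgc, hmaps, hgf⟩ := exists_continuousOn_extension_of_selfMap hf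
  obtain ⟨x, hxC, hx⟩ := hX.exists_approx_fixedPoint_seq hmaps
    (fun φ hφ => hb.exists_abs_le ⟨φ, (hτ.continuous_iff _).2 hφ⟩)
    (fun n φ ε hφ hε => @exists_approx_fixedPoint_of_finite X _ _ τ hτ.isTopologicalAddGroup
      hτ.continuousSMul C hne hb hconv g hgc hmaps (Fin n) _
      (fun i => ⟨φ i, (hτ.continuous_iff _).2 (hφ i)⟩) ε hε)
  refine ⟨fun n => ⟨x n, hxC n⟩, fun φ _ => ?_⟩
  refine (hx φ.toLinearMap ((hτ.continuous_iff _).1 φ.cont)).congr fun n => ?_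
  rw [← hgf]
  rfl

theorem AFPP.IsAlephZeroMonolithic.hasAFPP {X : Type*} [NormedAddCommGroup X] [NormedSpace ℝ X]
    (hX : AFPP.IsAlephZeroMonolithic (WeakDual ℝ X)) :
    AFPP.HasAFPP (StrongDual ℝ X)
      (LinearMap.range (NormedSpace.inclusionInDoubleDual ℝ X).toLinearMap) := by
  intro C hne hb _ hconv f hf
  obtain ⟨g, hgc, hmaps, hgf⟩ := exists_continuousOn_extension_of_selfMap hf
  have hbC := (NormedSpace.isVonNBounded_iff ℝ).1 hb
  obtain ⟨D, hDC, hDc, hD⟩ := exists_countable_approx_fixedPoints hne hbC hconv hgc hmaps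
  obtain ⟨M, hM⟩ := hbC.exists_norm_le
  obtain ⟨u, huS, hu⟩ := hX.exists_null_seq
    (S := (fun a => a - g a) '' D)
    (isBounded_iff_forall_norm_le.2 ⟨M + M, by
      rintro _ ⟨a, ha, rfl⟩
      exact (norm_sub_le _ _).trans (add_le_add (hM _ (hDC ha)) (hM _ (hmaps (hDC ha))))⟩)
    (hDc.image _) (by
      intro z n ε hε
      obtain ⟨a, ha, h⟩ := hD (fun i => NormedSpace.inclusionInDoubleDual ℝ X (z i)) n ε hε
      exact ⟨_, ⟨a, ha, rfl⟩, h⟩)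
  choose a haD ha using huS
  refine ⟨fun n => ⟨a n, hDC (haD n)⟩, ?_⟩
  rintro _ ⟨y, rfl⟩
  refine (hu y).congr fun n => ?_
  rw [← ha n, ← hgf]
  rfl

theorem proposition2p3 (X : Type*) [NormedAddCommGroup X] [NormedSpace ℝ X] :
    (AFPP.IsAsplund (UniformSpace.Completion X) →
      ∀ τ : TopologicalSpace X, AFPP.IsCompatibleLC X τ →
        @AFPP.HasWeakAFPP X _ _ τ) ∧
    (AFPP.IsAlephZeroMonolithic (WeakDual ℝ X) →
      AFPP.HasAFPP (StrongDual ℝ X)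
        (LinearMap.range (NormedSpace.inclusionInDoubleDual ℝ X).toLinearMap)) :=
  ⟨fun hX τ hτ => hX.hasWeakAFPP τ hτ, fun hX => hX.hasAFPP⟩
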